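/- Let $n,d\ge 1$ and $k\ge 0$ be integers. For a set $R$ of positive integers, let ${m \brace j}_R$ be the number of partitions of $[m]=\{1,\dots,m\}$ into $j$ non-empty parts whose sizes all lie in $R$, and let ${m \brace j}_R^{-1}$ be the entry in row $m$ and column $j$ of the inverse of the infinite matrix $\big[{m \brace j}_R\big]_{m,j\ge 1}$, when this inverse exists; for $j\le 0<m$ both numbers are read as $0$. Let $\Pi_n^{1,d}$ be the poset, ordered by refinement, of all partitions of $[n]$ whose part sizes are all congruent to $1$ modulo $d$; its least element $0$ is the partition into singletons. For a finite ranked poset $P$ with unique minimal element $0$, let $W_k(P)$ be the number of elements of rank $k$ (the $k$-th Whitney number of the second kind) and let $w_k(P)=\sum_x \mu(0,x)$, where $\mu$ is the Möbius function of $P$ and $x$ ranges over the elements of rank $k$ (the $k$-th Whitney number of the first kind). For integers $m\ge1$ and $j$, let $\mathcal H(m,j)$ be the set of unordered collections of $j$ plane rooted trees with $m$ leaves in total (an isolated root is a leaf), in which every non-leaf has at least two children and the leaves are labeled bijectively with $1,\dots,m$ in such a way that $\ell(v)$ increases from left to right across each set of siblings, where $\ell(v)$ is the largest label of a leaf descended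 from $v$ (so $\mathcal H(m,j)=\emptyset$ for $j\le 0$). Then $\Pi_n^{1,d}$ is ranked, the matrix $\big[{m \brace j}_{\{1,d+1,2d+1,\dots\}}\big]_{m,j\ge 1}$ has a unique inverse, and $$W_k(\Pi_n^{1,d}) = {n \brace n-kd}_{\{1,d+1,2d+1,\dots\}},\qquad w_k(\Pi_n^{1,d}) = {n \brace n-kd}^{-1}_{\{1,d+1,2d+1,\dots\}}.$$ In particular, $w_k(\Pi_n^{1,d})$ is $(-1)^k$ times the (finite) number of forests in $\mathcal H(n,n-kd)$ in which each vertex has $0$ or $d+1$ children and in which left-most children are always leaves. -/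

import Mathlib

namespace RestrictedWhitney

section Whitney

variable (P : Type*) [PartialOrder P] [Fintype P] [OrderBot P]

open Classical in
/-- The Möbius function of a finite poset, with integer values. -/
noncomputable def moebius (x y : P) : ℤ :=
  letI : LocallyFiniteOrder P := Fintype.toLocallyFiniteOrder
  IncidenceAlgebra.mu ℤ x y

variable [GradeMinOrder ℕ P]

open Classical in
/-- The `k`-th Whitney number of the second kind of a finite ranked poset with `⊥`: the number of
elements of rank `k`. The rank function is `grade ℕ`; a `GradeMinOrder ℕ` structure says exactly
that it vanishes on minimal elements and goes up by one along each covering relation. -/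
noncomputable def whitneySecond (k : ℕ) : ℕ :=
  (Finset.univ.filter fun x : P => grade ℕ x = k).card

open Classical in
/-- The `k`-th Whitney number of the first kind: the sum of `μ(⊥, x)` over the `x` of rank `k`. -/
noncomputable def whitneyFirst (k : ℕ) : ℤ :=
  ∑ x ∈ Finset.univ.filter (fun x : P => grade ℕ x = k), moebius P ⊥ x

end Whitney

/-- The partitions of `{1, …, n}` all of whose part sizes are congruent to `1` modulo `d`, ordered
by refinement (`σ ≤ τ` if and only if every part of `σ` is contained in a part of `τ`). -/
abbrev PartitionPoset (n d : ℕ) : Type :=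
  {σ : Finpartition (Finset.Icc 1 n) // ∀ s ∈ σ.parts, s.card ≡ 1 [MOD d]}

/-- The least element is the partition into singletons. -/
instance (n d : ℕ) : OrderBot (PartitionPoset n d) where
  bot := ⟨⊥, fun s hs => by
    obtain ⟨a, _, rfl⟩ := Finpartition.mem_bot_iff.1 hs
    rw [Finset.card_singleton]⟩
  bot_le σ := (bot_le : (⊥ : Finpartition (Finset.Icc 1 n)) ≤ σ.1)

/-- The `R`-restricted Stirling number of the second kind: the number of partitions of `{1, …, n}`
into `k` non-empty parts, all of whose sizes lie in `R`. -/
noncomputable def stirling (R : Set ℕ) (n k : ℕ) : ℕ :=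
  Nat.card {σ : Finpartition (Finset.Icc 1 n) //
    σ.parts.card = k ∧ ∀ s ∈ σ.parts, s.card ∈ R}

/-- The infinite matrix of `R`-restricted Stirling numbers, with rows and columns indexed by the
positive integers. -/
noncomputable def stirlingMatrix (R : Set ℕ) : Matrix ℕ+ ℕ+ ℤ :=
  fun n k => (stirling R n k : ℤ)

/-- The product of the infinite matrices `A` and `B` is defined (every entry is a finite sum) and
it is the identity matrix. -/
def MulEqOne (A B : Matrix ℕ+ ℕ+ ℤ) : Prop :=
  ∀ n k, (Function.support fun j => A n j * B j k).Finite ∧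
    ∑ᶠ j, A n j * B j k = if n = k then 1 else 0

/-- `B` is a two-sided inverse of the infinite matrix `A`. -/
def IsInverse (A B : Matrix ℕ+ ℕ+ ℤ) : Prop :=
  MulEqOne A B ∧ MulEqOne B A

open Classical in
/-- The inverse of an infinite matrix, when there is one (and `0` otherwise). -/
noncomputable def inverseMatrix (A : Matrix ℕ+ ℕ+ ℤ) : Matrix ℕ+ ℕ+ ℤ :=
  if h : ∃ B, IsInverse A B then h.choose else 0

/-- The inverse `R`-restricted Stirling number of the second kind: the `(n, k)` entry of the inverse
of the matrix of `R`-restricted Stirling numbers, for `n, k ≥ 1`; outside of this index range it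
is `0`. -/
noncomputable def inverseStirling (R : Set ℕ) (n k : ℕ) : ℤ :=
  if h : 0 < n ∧ 0 < k then inverseMatrix (stirlingMatrix R) ⟨n, h.1⟩ ⟨k, h.2⟩ else 0

/-- The set `{1, d + 1, 2 d + 1, …}`. -/
def progression (d : ℕ) : Set ℕ := {m | ∃ j : ℕ, m = j * d + 1}

/-- Plane rooted trees with leaves labeled by natural numbers: a tree is a labeled leaf, or a root
with subtrees `c 0, …, c (m - 1)` listed from left to right. -/
inductive PlaneTree : Type
  | leaf (a : ℕ) : PlaneTree
  | node (m : ℕ) (c : Fin m → PlaneTree) : PlaneTree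

namespace PlaneTree

/-- The tree is a single leaf, i.e. its root is a leaf. -/
def IsLeaf : PlaneTree → Prop
  | leaf _ => True
  | node _ _ => False

/-- The multiset of all leaf labels. -/
def leafLabels : PlaneTree → Multiset ℕ
  | leaf a => {a}
  | node _ c => ∑ i, leafLabels (c i)

/-- The label `ℓ(v)` of the root `v`: the largest label of a leaf descended from it. -/
def maxLabel : PlaneTree → ℕ
  | leaf a => a
  | node _ c => Finset.univ.sup fun i => maxLabel (c i)

/-- Every non-leaf vertex has at least two children. -/
def NonLeavesBranch : PlaneTree → Prop
  | leaf _ => True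
  | node m c => 2 ≤ m ∧ ∀ i, NonLeavesBranch (c i)

/-- The labels `ℓ(v)` increase from left to right across each set of siblings. -/
def SiblingsIncrease : PlaneTree → Prop
  | leaf _ => True
  | node _ c => (StrictMono fun i => maxLabel (c i)) ∧ ∀ i, SiblingsIncrease (c i)

/-- Every vertex has either `0` or `r` children, where those with `0` children are leaves. -/
def DegreesZeroOr (r : ℕ) : PlaneTree → Prop
  | leaf _ => True
  | node m c => m = r ∧ ∀ i, DegreesZeroOr r (c i)

/-- Every left-most child is a leaf. -/
def LeftmostAreLeaves : PlaneTree → Prop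
  | leaf _ => True
  | node _ c => (∀ i, i.val = 0 → IsLeaf (c i)) ∧ ∀ i, LeftmostAreLeaves (c i)

end PlaneTree

/-- The set `H(n, k)` of unordered collections of `k` plane rooted trees, with `n` leaves in total,
labeled bijectively with `1, …, n`, such that all non-leaves have at least two children and `ℓ(v)`
increases from left to right across each set of siblings. The trees are pairwise distinct because
their sets of labels are non-empty and disjoint, so a collection of trees is a `Finset`. -/
def forests (n k : ℕ) : Set (Finset PlaneTree) :=
  {F | F.card = k ∧ ∑ T ∈ F, T.leafLabels = (Finset.Icc 1 n).val ∧
    ∀ T ∈ F, T.NonLeavesBranch ∧ T.SiblingsIncrease}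

/-- The forests in `H(n, k)` whose vertices have `0` or `d + 1` children and whose left-most
children are leaves. -/
def goodForests (d n k : ℕ) : Set (Finset PlaneTree) :=
  {F | F ∈ forests n k ∧ ∀ T ∈ F, T.DegreesZeroOr (d + 1) ∧ T.LeftmostAreLeaves}

end RestrictedWhitney

namespace RestrictedWhitney

open Finset

/-! Sizes congruent to 1 modulo `d` add up, modulo `d`, to the number of summands. So a part of `τ`
contains 1 modulo `d` parts of any `σ ≤ τ`. If `σ < τ`, some part contains at least `d + 1` of them,
and merging `d + 1` of these stays below `τ` (`exists_merge_of_lt`). Hence the poset is ranked by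
`(n - number of parts) / d`, and `W_k` is a restricted Stirling number.

The partitions above `σ` correspond to the admissible partitions of its set of parts
(`card_filter_le`). Summing `μ(0, σ)` over pairs `σ ≤ τ`, with `τ` having `k` parts, therefore gives
an entry of the product of the matrix of sums of Möbius values with the Stirling matrix. By the
defining recursion of `μ` this product is the identity (`sum_moebiusSum_mul_stirling`). Both
matrices are lower triangular, so the left inverse is the unique two-sided inverse.

For the forest count, `μ(0, τ)` is the sum of `(-1) ^ rank` over the good forests whose label sets
form `τ`. It suffices that the signed count of forests refining `τ ≠ 0` vanishes
(`sum_sign_eq_zero`). Fix a part `B` of `τ` with at least two elements and look at the tree inside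
`B` with least maximal label. If it is not a leaf, break it into its `d + 1` subtrees; if it is a
leaf, join the `d + 1` trees inside `B` with least maximal labels under a new root. These operations
are mutually inverse and change the rank by one. -/

lemma sum_modEq_card {ι : Type*} {d : ℕ} {D : Finset ι} {f : ι → ℕ}
    (hD : ∀ i ∈ D, f i ≡ 1 [MOD d]) : ∑ i ∈ D, f i ≡ D.card [MOD d] := by
  classical
  induction D using Finset.induction_on with
  | empty => simp [Nat.ModEq]
  | insert i D hi ih =>
    rw [sum_insert hi, card_insert_of_notMem hi, add_comm]
    exact (ih fun j hj => hD j (mem_insert_of_mem hj)).add (hD i (mem_insert_self _ _))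

/-! ### Refinement and merging of parts. -/

section Finpartition

variable {α : Type*} [DecidableEq α] {s : Finset α}

/-- A part of a coarser partition is the union of the finer parts that it contains. -/
lemma biUnion_filter_subset {σ τ : Finpartition s} (h : σ ≤ τ) {B : Finset α}
    (hB : B ∈ τ.parts) : (σ.parts.filter (· ⊆ B)).biUnion id = B := by
  ext x
  simp only [mem_biUnion, mem_filter, id]
  constructor
  · rintro ⟨A, ⟨-, hA⟩, hx⟩
    exact hA hx
  · intro hx
    obtain ⟨A, hA, hxA⟩ := σ.exists_mem (τ.subset hB hx)
    obtain ⟨C, hC, hAC⟩ := h hA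
    have : C = B := τ.eq_of_mem_parts hC hB (hAC hxA) hx
    exact ⟨A, ⟨hA, this ▸ hAC⟩, hxA⟩

lemma card_eq_sum_filter_subset {σ τ : Finpartition s} (h : σ ≤ τ) {B : Finset α}
    (hB : B ∈ τ.parts) : B.card = ∑ A ∈ σ.parts.filter (· ⊆ B), A.card := by
  conv_lhs => rw [← biUnion_filter_subset h hB]
  rw [card_biUnion]
  · rfl
  · intro A hA C hC hAC
    exact σ.disjoint (mem_filter.1 hA).1 (mem_filter.1 hC).1 hAC

lemma filter_subset_nonempty {σ τ : Finpartition s} (h : σ ≤ τ) {B : Finset α}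
    (hB : B ∈ τ.parts) : (σ.parts.filter (· ⊆ B)).Nonempty := by
  rw [nonempty_iff_ne_empty]
  intro h0
  have := biUnion_filter_subset h hB
  rw [h0, biUnion_empty] at this
  exact τ.ne_bot hB this.symm

/-- The partition obtained by merging the parts in `D`. -/
def mergeParts (σ : Finpartition s) (D : Finset (Finset α)) (hD : D ⊆ σ.parts)
    (hne : D.Nonempty) : Finpartition s :=
  Finpartition.ofExistsUnique (insert (D.biUnion id) (σ.parts \ D))
    (by
      intro p hp
      rcases mem_insert.1 hp with rfl | hp
      · exact biUnion_subset.2 fun A hA => σ.subset (hD hA)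
      · exact σ.subset (mem_sdiff.1 hp).1)
    (by
      intro a ha
      obtain ⟨A, hA, haA⟩ := σ.exists_mem ha
      by_cases hAD : A ∈ D
      · refine ⟨D.biUnion id, ⟨mem_insert_self _ _, mem_biUnion.2 ⟨A, hAD, haA⟩⟩, ?_⟩
        rintro C ⟨hC, haC⟩
        rcases mem_insert.1 hC with rfl | hC
        · rfl
        · rw [mem_sdiff] at hC
          exact absurd (σ.eq_of_mem_parts hC.1 hA haC haA ▸ hAD) hC.2
      · refine ⟨A, ⟨mem_insert_of_mem (mem_sdiff.2 ⟨hA, hAD⟩), haA⟩, ?_⟩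
        rintro C ⟨hC, haC⟩
        rcases mem_insert.1 hC with rfl | hC
        · obtain ⟨E, hE, haE⟩ := mem_biUnion.1 haC
          exact absurd (σ.eq_of_mem_parts (hD hE) hA haE haA ▸ hE) hAD
        · exact σ.eq_of_mem_parts (mem_sdiff.1 hC).1 hA haC haA)
    (by
      intro h
      rcases mem_insert.1 h with h | h
      · obtain ⟨A, hA⟩ := hne
        obtain ⟨x, hx⟩ := σ.nonempty_of_mem_parts (hD hA)
        have : x ∈ D.biUnion id := mem_biUnion.2 ⟨A, hA, hx⟩
        rw [← h] at this
        exact absurd this (notMem_empty _)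
      · exact σ.bot_notMem (mem_sdiff.1 h).1)

lemma mergeParts_parts (σ : Finpartition s) (D : Finset (Finset α)) (hD : D ⊆ σ.parts)
    (hne : D.Nonempty) :
    (mergeParts σ D hD hne).parts = insert (D.biUnion id) (σ.parts \ D) := rfl

lemma le_mergeParts (σ : Finpartition s) (D : Finset (Finset α)) (hD : D ⊆ σ.parts)
    (hne : D.Nonempty) : σ ≤ mergeParts σ D hD hne := by
  intro A hA
  rw [mergeParts_parts]
  by_cases h : A ∈ D
  · exact ⟨_, mem_insert_self _ _, subset_biUnion_of_mem id h⟩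
  · exact ⟨A, mem_insert_of_mem (mem_sdiff.2 ⟨hA, h⟩), le_rfl⟩

lemma card_mergeParts (σ : Finpartition s) (D : Finset (Finset α)) (hD : D ⊆ σ.parts)
    (hne : D.Nonempty) :
    (mergeParts σ D hD hne).parts.card + D.card = σ.parts.card + 1 := by
  rw [mergeParts_parts, card_insert_of_notMem, card_sdiff_of_subset hD]
  · have := card_le_card hD
    omega
  · intro h
    rw [mem_sdiff] at h
    obtain ⟨A, hA⟩ := hne
    obtain ⟨x, hx⟩ := σ.nonempty_of_mem_parts (hD hA)
    have := σ.eq_of_mem_parts (hD hA) h.1 hx (mem_biUnion.2 ⟨A, hA, hx⟩)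
    exact h.2 (this ▸ hA)

end Finpartition

/-! ### The rank function and the Whitney numbers of the second kind. -/

section Grade

variable {n d : ℕ}

/-- This makes the division by `d` in `rank` exact. -/
lemma card_parts_modEq (σ : PartitionPoset n d) : n ≡ σ.1.parts.card [MOD d] := by
  have h := sum_modEq_card (d := d) σ.2
  rwa [σ.1.sum_card_parts, Nat.card_Icc, Nat.add_sub_cancel] at h

lemma card_parts_le (σ : PartitionPoset n d) : σ.1.parts.card ≤ n := by
  simpa using σ.1.card_parts_le_card

/-- The rank of a partition in the poset `PartitionPoset n d`. -/
def rank (σ : PartitionPoset n d) : ℕ := (n - σ.1.parts.card) / d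

lemma card_parts_add_rank (σ : PartitionPoset n d) : σ.1.parts.card + rank σ * d = n := by
  have h : d ∣ n - σ.1.parts.card :=
    (Nat.modEq_iff_dvd' (card_parts_le σ)).1 (card_parts_modEq σ).symm
  rw [rank, Nat.div_mul_cancel h]
  have := card_parts_le σ
  omega

/-- The size of `B` modulo `d` is 1 because `B` is a part of `τ`, and it is also the number of parts
of `σ` that make up `B`. -/
lemma card_parts_filter_modEq {σ τ : PartitionPoset n d} (h : σ ≤ τ) {B : Finset ℕ}
    (hB : B ∈ τ.1.parts) : (σ.1.parts.filter (· ⊆ B)).card ≡ 1 [MOD d] := by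
  have h1 := card_eq_sum_filter_subset h hB
  have h2 := sum_modEq_card (d := d) (D := σ.1.parts.filter (· ⊆ B))
    fun A hA => σ.2 A (mem_filter.1 hA).1
  rw [← h1] at h2
  exact h2.symm.trans (τ.2 B hB)

/-- If `σ < τ` then some part of `τ` contains at least `d + 1` parts of `σ`. -/
lemma exists_part_of_lt {σ τ : PartitionPoset n d} (h : σ < τ) :
    ∃ B ∈ τ.1.parts, d + 1 ≤ (σ.1.parts.filter (· ⊆ B)).card := by
  by_contra! hcon
  refine h.not_ge ?_
  intro B hB
  have h1 : (σ.1.parts.filter (· ⊆ B)).card = 1 := by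
    -- A count between 1 and `d` that is 1 modulo `d` equals 1; if this holds for every `B`, then `τ
    -- ≤ σ`.
    have h2 := card_parts_filter_modEq h.le hB
    have h3 := hcon B hB
    have h4 := (filter_subset_nonempty h.le hB).card_pos
    have h5 : d ∣ (σ.1.parts.filter (· ⊆ B)).card - 1 := (Nat.modEq_iff_dvd' h4).1 h2.symm
    have h6 := Nat.eq_zero_of_dvd_of_lt h5 (by omega)
    omega
  obtain ⟨A, hA⟩ := card_eq_one.1 h1
  have h2 := biUnion_filter_subset h.le hB
  rw [hA, singleton_biUnion] at h2
  have h3 : A ∈ σ.1.parts.filter (· ⊆ B) := hA ▸ mem_singleton_self A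
  exact ⟨A, (mem_filter.1 h3).1, h2.ge⟩

/-- Below any strict coarsening there is one that merges exactly `d + 1` parts. -/
lemma exists_merge_of_lt (hd : 1 ≤ d) {σ τ : PartitionPoset n d} (h : σ < τ) :
    ∃ ρ : PartitionPoset n d, σ < ρ ∧ ρ ≤ τ ∧ rank ρ = rank σ + 1 := by
  obtain ⟨B, hB, hcard⟩ := exists_part_of_lt h
  obtain ⟨D, hD, hDc⟩ := exists_subset_card_eq hcard
  have hDσ : D ⊆ σ.1.parts := hD.trans (filter_subset _ _)
  have hne : D.Nonempty := card_pos.1 (by omega)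
  have hdisj : ((D : Set (Finset ℕ)).PairwiseDisjoint id) :=
    σ.1.disjoint.subset (by exact_mod_cast hDσ)
  let ρ : PartitionPoset n d := ⟨mergeParts σ.1 D hDσ hne, by
    intro s hs
    rw [mergeParts_parts] at hs
    rcases mem_insert.1 hs with rfl | hs
    -- The merged part consists of `d + 1` parts, so its size is again 1 modulo `d`.
    · rw [card_biUnion hdisj]
      refine (sum_modEq_card (d := d) fun A hA => σ.2 A (hDσ hA)).trans ?_
      rw [hDc]
      simp [Nat.ModEq]
    · exact σ.2 s (mem_sdiff.1 hs).1⟩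
  have hc := card_mergeParts σ.1 D hDσ hne
  have h1 := card_parts_add_rank σ
  have h2 : (mergeParts σ.1 D hDσ hne).parts.card + rank ρ * d = n := card_parts_add_rank ρ
  have hr : rank ρ = rank σ + 1 := by
    have : rank ρ * d = (rank σ + 1) * d := by
      rw [add_mul]
      omega
    exact Nat.eq_of_mul_eq_mul_right hd this
  refine ⟨ρ, lt_of_le_of_ne (le_mergeParts σ.1 D hDσ hne) ?_, ?_, hr⟩
  · intro heq
    rw [← heq] at hr
    omega
  · intro A hA
    rw [mergeParts_parts] at hA
    rcases mem_insert.1 hA with rfl | hA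
    · exact ⟨B, hB, biUnion_subset.2 fun C hC => (mem_filter.1 (hD hC)).2⟩
    · exact h.le (mem_sdiff.1 hA).1

lemma rank_strictMono (hd : 1 ≤ d) : StrictMono (rank : PartitionPoset n d → ℕ) := by
  intro σ τ h
  obtain ⟨ρ, -, h2, h3⟩ := exists_merge_of_lt hd h
  have h4 : rank ρ ≤ rank τ :=
    Nat.div_le_div_right (Nat.sub_le_sub_left (Finpartition.card_mono h2) n)
  omega

lemma rank_of_covBy (hd : 1 ≤ d) {σ τ : PartitionPoset n d} (h : σ ⋖ τ) :
    rank τ = rank σ + 1 := by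
  obtain ⟨ρ, h1, h2, h3⟩ := exists_merge_of_lt hd h.lt
  rcases h2.eq_or_lt with rfl | h2
  · exact h3
  · exact absurd h2 (h.2 h1)

lemma rank_bot : rank (⊥ : PartitionPoset n d) = 0 := by
  have : (⊥ : PartitionPoset n d).1.parts.card = n :=
    (Finpartition.card_bot (Icc 1 n)).trans (by simp)
  rw [rank, this, Nat.sub_self, Nat.zero_div]

lemma rank_eq_zero_iff (hd : 1 ≤ d) {σ : PartitionPoset n d} : rank σ = 0 ↔ σ = ⊥ := by
  constructor
  · intro h
    by_contra hne
    have := rank_strictMono hd (bot_lt_iff_ne_bot.2 hne)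
    omega
  · rintro rfl
    exact rank_bot

lemma nonempty_gradeMinOrder (hd : 1 ≤ d) : Nonempty (GradeMinOrder ℕ (PartitionPoset n d)) :=
  ⟨{ grade := rank
     grade_strictMono := rank_strictMono hd
     covBy_grade := fun _ _ h => by
       rw [rank_of_covBy hd h]
       exact Order.covBy_add_one _
     isMin_grade := fun σ h => by
       rw [isMin_iff_eq_bot.1 h, rank_bot]
       exact isMin_bot }⟩

/-- A grading is forced by its value at `⊥` and its increments along covers, so the results hold for
every `GradeMinOrder ℕ` structure. -/
lemma grade_eq_rank (hd : 1 ≤ d) [GradeMinOrder ℕ (PartitionPoset n d)]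
    (σ : PartitionPoset n d) : grade ℕ σ = rank σ := by
  induction σ using WellFoundedLT.induction with
  | ind σ ih =>
  rcases eq_or_ne σ ⊥ with rfl | hne
  · rw [rank_bot, grade_bot]
    rfl
  · obtain ⟨τ, hτ⟩ := (exists_covBy_of_wellFoundedGT (a := σ) (by rwa [isMin_iff_eq_bot]))
    have h1 := Order.covBy_iff_add_one_eq.1 (hτ.grade ℕ)
    rw [rank_of_covBy hd hτ, ← ih τ hτ.lt, h1]

lemma mem_progression {d m : ℕ} : m ∈ progression d ↔ 1 ≤ m ∧ m ≡ 1 [MOD d] := by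
  constructor
  · rintro ⟨j, rfl⟩
    refine ⟨by omega, ?_⟩
    simp [Nat.ModEq]
  · rintro ⟨h1, h2⟩
    obtain ⟨j, hj⟩ := (Nat.modEq_iff_dvd' h1).1 h2.symm
    exact ⟨j, by rw [mul_comm]; omega⟩

lemma rank_eq_iff (hn : 1 ≤ n) (hd : 1 ≤ d) {σ : PartitionPoset n d} {k : ℕ} :
    rank σ = k ↔ σ.1.parts.card = n - k * d := by
  have h := card_parts_add_rank σ
  have hpos : 0 < σ.1.parts.card :=
    card_pos.2 (σ.1.parts_nonempty (by simp; omega))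
  constructor
  · rintro rfl
    omega
  · intro h'
    exact Nat.eq_of_mul_eq_mul_right hd (by omega)

lemma stirling_eq_card (n d j : ℕ) :
    stirling (progression d) n j
      = (univ.filter fun σ : PartitionPoset n d => σ.1.parts.card = j).card := by
  rw [stirling, ← Fintype.card_subtype, ← Nat.card_eq_fintype_card]
  refine Nat.card_congr
    { toFun := fun σ => ⟨⟨σ.1, fun s hs => (mem_progression.1 (σ.2.2 s hs)).2⟩, σ.2.1⟩
      invFun := fun σ => ⟨σ.1.1, σ.2, fun s hs => mem_progression.2
        ⟨card_pos.2 (σ.1.1.nonempty_of_mem_parts hs), σ.1.2 s hs⟩⟩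
      left_inv := fun _ => rfl
      right_inv := fun _ => rfl }

lemma whitneySecond_eq (hn : 1 ≤ n) (hd : 1 ≤ d) [GradeMinOrder ℕ (PartitionPoset n d)] (k : ℕ) :
    whitneySecond (PartitionPoset n d) k = stirling (progression d) n (n - k * d) := by
  rw [stirling_eq_card, whitneySecond]
  congr 1
  ext σ
  simp only [mem_filter, mem_univ, true_and, grade_eq_rank hd, rank_eq_iff hn hd]

end Grade

/-! ### Inverses of lower triangular infinite matrices. -/

section InfiniteMatrix

variable {A B C : Matrix ℕ+ ℕ+ ℤ}

/-- An infinite matrix is lower triangular if its entries above the diagonal vanish. -/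
def LowerTriangular (A : Matrix ℕ+ ℕ+ ℤ) : Prop := ∀ n k, n < k → A n k = 0

/-- Row `n` of `A` ends at column `n`, so `A` can be multiplied on the right by any matrix. -/
lemma LowerTriangular.support_subset (hA : LowerTriangular A) (B : Matrix ℕ+ ℕ+ ℤ) (n k : ℕ+) :
    (Function.support fun j => A n j * B j k) ⊆ (Iic n : Finset ℕ+) := by
  intro j hj
  rw [coe_Iic, Set.mem_Iic]
  by_contra h
  exact hj (by simp only [hA n j (not_le.1 h), zero_mul])

lemma LowerTriangular.mulEqOne_iff (hA : LowerTriangular A) :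
    MulEqOne A B ↔ ∀ n k, ∑ j ∈ Iic n, A n j * B j k = if n = k then 1 else 0 := by
  refine forall₂_congr fun n k => ?_
  rw [finsum_eq_sum_of_support_subset _ (hA.support_subset B n k)]
  exact and_iff_right ((finite_toSet _).subset (hA.support_subset B n k))

/-- For lower triangular infinite matrices, a left inverse is a right inverse. -/
lemma LowerTriangular.mulEqOne_symm (hA : LowerTriangular A) (hB : LowerTriangular B)
    (h : MulEqOne A B) : MulEqOne B A := by
  rw [hA.mulEqOne_iff] at h
  rw [hB.mulEqOne_iff]
  intro n k
  -- Triangularity lets the product be computed in the upper left corner of size `N`, where a left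
  -- inverse of a finite square matrix is a right inverse.
  let N := max n k
  let A' : Matrix (Iic N : Finset ℕ+) (Iic N : Finset ℕ+) ℤ := fun i j => A i j
  let B' : Matrix (Iic N : Finset ℕ+) (Iic N : Finset ℕ+) ℤ := fun i j => B i j
  have extend : ∀ {A B : Matrix ℕ+ ℕ+ ℤ}, LowerTriangular A → ∀ i ≤ N, ∀ k,
      ∑ j : (Iic N : Finset ℕ+), A i j * B j k = ∑ j ∈ Iic i, A i j * B j k := by
    intro A B hA i hi k
    rw [sum_coe_sort (Iic N) fun j => A i j * B j k]
    refine (sum_subset (Iic_subset_Iic.2 hi) fun j _ hj => ?_).symm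
    rw [hA i j (by simpa using hj), zero_mul]
  have h1 : A' * B' = 1 := by
    ext i j
    rw [Matrix.mul_apply, Matrix.one_apply]
    refine (extend hA i.1 (mem_Iic.1 i.2) j.1).trans ((h i.1 j.1).trans ?_)
    simp only [Subtype.ext_iff]
  have hcomm : B' * A' = 1 := mul_eq_one_comm.1 h1
  have h2 := congrFun (congrFun hcomm ⟨n, by simp [N]⟩) ⟨k, by simp [N]⟩
  rw [Matrix.mul_apply, Matrix.one_apply] at h2
  rw [← extend hB n (le_max_left _ _) k]
  refine h2.trans ?_
  simp only [Subtype.mk.injEq]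

/-- A left inverse and a right inverse of a lower triangular matrix agree. -/
lemma LowerTriangular.eq_of_mulEqOne (hA : LowerTriangular A) (hB : LowerTriangular B)
    (hBA : MulEqOne B A) (hAC : MulEqOne A C) : C = B := by
  rw [hB.mulEqOne_iff] at hBA
  rw [hA.mulEqOne_iff] at hAC
  ext n k
  -- Associativity `(B A) C = B (A C)`. Triangularity bounds all sums by `n`, so no triangularity of
  -- `C` is needed.
  have key : ∑ j ∈ Iic n, (∑ i ∈ Iic n, B n i * A i j) * C j k
      = ∑ i ∈ Iic n, B n i * ∑ j ∈ Iic i, A i j * C j k := by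
    simp only [sum_mul, mul_sum]
    rw [sum_comm]
    refine sum_congr rfl fun i hi => ?_
    simp only [mul_assoc]
    refine (sum_subset (Iic_subset_Iic.2 (mem_Iic.1 hi)) fun j _ hj => ?_).symm
    rw [hA i j (by simpa using hj), zero_mul, mul_zero]
  simp only [hBA, hAC, ite_mul, mul_ite, one_mul, mul_one, zero_mul, mul_zero, sum_ite_eq,
    sum_ite_eq', mem_Iic, le_refl, if_true] at key
  rw [key, ite_eq_left_iff]
  exact fun hk => (hB n k (not_le.1 hk)).symm

lemma LowerTriangular.isInverse (hA : LowerTriangular A) (hB : LowerTriangular B)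
    (hBA : MulEqOne B A) : IsInverse A B :=
  ⟨hB.mulEqOne_symm hA hBA, hBA⟩

lemma LowerTriangular.inverseMatrix_eq (hA : LowerTriangular A) (hB : LowerTriangular B)
    (hBA : MulEqOne B A) : inverseMatrix A = B := by
  have h : ∃ B, IsInverse A B := ⟨B, hA.isInverse hB hBA⟩
  rw [inverseMatrix, dif_pos h]
  exact hA.eq_of_mulEqOne hB hBA h.choose_spec.1

end InfiniteMatrix

/-! ### Coarsenings of a partition as partitions of its set of parts. -/

section Coarsening

variable {α β : Type*} [DecidableEq α] {s : Finset α} {t : Finset β}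
  {σ : Finpartition s} {g : β → Finset α}

lemma eq_of_mem_of_mem (hg : Set.BijOn g t σ.parts) {i j : β} (hi : i ∈ t) (hj : j ∈ t) {x : α}
    (hxi : x ∈ g i) (hxj : x ∈ g j) : i = j :=
  hg.injOn hi hj (σ.eq_of_mem_parts (hg.mapsTo hi) (hg.mapsTo hj) hxi hxj)

/-- The parts `g i` are non-empty and disjoint, so a set of indices can be recovered from the union
of its parts. This makes `coarsening` injective. -/
lemma filter_subset_biUnion (hg : Set.BijOn g t σ.parts) {C : Finset β} (hC : C ⊆ t) :
    t.filter (g · ⊆ C.biUnion g) = C := by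
  ext i
  rw [mem_filter]
  constructor
  · rintro ⟨hi, hiC⟩
    obtain ⟨x, hx⟩ := σ.nonempty_of_mem_parts (hg.mapsTo hi)
    obtain ⟨j, hj, hxj⟩ := mem_biUnion.1 (hiC hx)
    rwa [eq_of_mem_of_mem hg hi (hC hj) hx hxj]
  · exact fun hi => ⟨hC hi, subset_biUnion_of_mem g hi⟩

lemma biUnion_filter_subset_of_bijOn (hg : Set.BijOn g t σ.parts) {τ : Finpartition s}
    (h : σ ≤ τ) {B : Finset α} (hB : B ∈ τ.parts) : (t.filter (g · ⊆ B)).biUnion g = B := by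
  conv_rhs => rw [← biUnion_filter_subset h hB]
  ext x
  simp only [mem_biUnion, mem_filter, id]
  constructor
  · rintro ⟨i, ⟨hi, hiB⟩, hx⟩
    exact ⟨g i, ⟨hg.mapsTo hi, hiB⟩, hx⟩
  · rintro ⟨A, ⟨hA, hAB⟩, hx⟩
    obtain ⟨i, hi, rfl⟩ := hg.surjOn hA
    exact ⟨i, ⟨hi, hAB⟩, hx⟩

lemma card_biUnion_of_bijOn (hg : Set.BijOn g t σ.parts) {C : Finset β} (hC : C ⊆ t) :
    (C.biUnion g).card = ∑ i ∈ C, (g i).card :=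
  card_biUnion fun i hi j hj hij => by
    refine σ.disjoint (hg.mapsTo (hC hi)) (hg.mapsTo (hC hj)) fun h => hij ?_
    exact hg.injOn (hC hi) (hC hj) h

variable [DecidableEq β]

/-- The coarsening of `σ` given by a partition of a set that indexes the parts of `σ`. -/
def coarsening (hg : Set.BijOn g t σ.parts) (ρ : Finpartition t) : Finpartition s :=
  Finpartition.ofExistsUnique (ρ.parts.image (·.biUnion g))
    (by
      intro p hp
      obtain ⟨C, hC, rfl⟩ := mem_image.1 hp
      exact biUnion_subset.2 fun i hi => σ.subset (hg.mapsTo (ρ.subset hC hi)))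
    (by
      intro a ha
      obtain ⟨A, hA, haA⟩ := σ.exists_mem ha
      obtain ⟨i, hi, rfl⟩ := hg.surjOn hA
      obtain ⟨C, hC, hiC⟩ := ρ.exists_mem hi
      refine ⟨C.biUnion g, ⟨mem_image_of_mem _ hC, mem_biUnion.2 ⟨i, hiC, haA⟩⟩, ?_⟩
      rintro E ⟨hE, haE⟩
      obtain ⟨E, hE', rfl⟩ := mem_image.1 hE
      obtain ⟨j, hj, haj⟩ := mem_biUnion.1 haE
      obtain rfl := eq_of_mem_of_mem hg hi (ρ.subset hE' hj) haA haj
      rw [ρ.eq_of_mem_parts hE' hC hj hiC])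
    (by
      intro h
      obtain ⟨C, hC, hC0⟩ := mem_image.1 h
      obtain ⟨i, hi⟩ := ρ.nonempty_of_mem_parts hC
      obtain ⟨x, hx⟩ := σ.nonempty_of_mem_parts (hg.mapsTo (ρ.subset hC hi))
      have : x ∈ C.biUnion g := mem_biUnion.2 ⟨i, hi, hx⟩
      rw [hC0] at this
      exact notMem_empty _ this)

lemma coarsening_parts (hg : Set.BijOn g t σ.parts) (ρ : Finpartition t) :
    (coarsening hg ρ).parts = ρ.parts.image (·.biUnion g) := rfl

lemma le_coarsening (hg : Set.BijOn g t σ.parts) (ρ : Finpartition t) :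
    σ ≤ coarsening hg ρ := by
  intro A hA
  obtain ⟨i, hi, rfl⟩ := hg.surjOn hA
  obtain ⟨C, hC, hiC⟩ := ρ.exists_mem hi
  exact ⟨_, mem_image_of_mem _ hC, subset_biUnion_of_mem g hiC⟩

lemma card_coarsening (hg : Set.BijOn g t σ.parts) (ρ : Finpartition t) :
    (coarsening hg ρ).parts.card = ρ.parts.card := by
  refine card_image_of_injOn fun C hC E hE h => ?_
  rw [← filter_subset_biUnion hg (ρ.subset hC), ← filter_subset_biUnion hg (ρ.subset hE)]
  exact congrArg (fun B => t.filter (g · ⊆ B)) h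

lemma coarsening_injective (hg : Set.BijOn g t σ.parts) :
    Function.Injective (coarsening hg) := by
  have key : ∀ ρ ρ' : Finpartition t, coarsening hg ρ = coarsening hg ρ' →
      ρ.parts ⊆ ρ'.parts := by
    intro ρ ρ' h C hC
    have h1 : C.biUnion g ∈ (coarsening hg ρ').parts := h ▸ mem_image_of_mem _ hC
    obtain ⟨E, hE, hEC⟩ := mem_image.1 h1
    rw [← filter_subset_biUnion hg (ρ.subset hC), ← hEC,
      filter_subset_biUnion hg (ρ'.subset hE)]
    exact hE
  exact fun ρ ρ' h => Finpartition.ext ((key ρ ρ' h).antisymm (key ρ' ρ h.symm))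

/-- The partition of the set indexing the parts of `σ` that is given by a coarsening of `σ`. -/
def indexPartition (hg : Set.BijOn g t σ.parts) {τ : Finpartition s} (h : σ ≤ τ) :
    Finpartition t :=
  Finpartition.ofExistsUnique (τ.parts.image fun B => t.filter (g · ⊆ B))
    (by
      intro p hp
      obtain ⟨B, -, rfl⟩ := mem_image.1 hp
      exact filter_subset _ _)
    (by
      intro i hi
      obtain ⟨B, hB, hiB⟩ := h (hg.mapsTo hi)
      refine ⟨_, ⟨mem_image_of_mem _ hB, mem_filter.2 ⟨hi, hiB⟩⟩, ?_⟩
      rintro E ⟨hE, hiE⟩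
      obtain ⟨E, hE', rfl⟩ := mem_image.1 hE
      obtain ⟨x, hx⟩ := σ.nonempty_of_mem_parts (hg.mapsTo hi)
      rw [τ.eq_of_mem_parts hE' hB ((mem_filter.1 hiE).2 hx) (hiB hx)])
    (by
      intro h0
      obtain ⟨B, hB, hB0⟩ := mem_image.1 h0
      have := biUnion_filter_subset_of_bijOn hg h hB
      rw [hB0, biUnion_empty] at this
      exact τ.ne_bot hB this.symm)

lemma indexPartition_parts (hg : Set.BijOn g t σ.parts) {τ : Finpartition s} (h : σ ≤ τ) :
    (indexPartition hg h).parts = τ.parts.image fun B => t.filter (g · ⊆ B) := rfl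

lemma coarsening_indexPartition (hg : Set.BijOn g t σ.parts) {τ : Finpartition s} (h : σ ≤ τ) :
    coarsening hg (indexPartition hg h) = τ := by
  refine Finpartition.ext ?_
  rw [coarsening_parts, indexPartition_parts, image_image]
  exact (image_congr fun B hB => biUnion_filter_subset_of_bijOn hg h hB).trans image_id

end Coarsening

/-- The partitions above `σ` are counted by the partitions of the set of parts of `σ`. -/
lemma card_filter_le {n d : ℕ} (σ : PartitionPoset n d) (k : ℕ) [DecidableLE (PartitionPoset n d)] :
    (univ.filter fun τ : PartitionPoset n d => σ ≤ τ ∧ τ.1.parts.card = k).card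
      = stirling (progression d) σ.1.parts.card k := by
  rw [stirling_eq_card]
  obtain ⟨g, hg⟩ : ∃ g : ℕ → Finset ℕ, Set.BijOn g (Icc 1 σ.1.parts.card) σ.1.parts :=
    (finite_toSet _).exists_bijOn_of_encard_eq (by
      rw [Set.encard_coe_eq_coe_finsetCard, Set.encard_coe_eq_coe_finsetCard, Nat.card_Icc,
        Nat.add_sub_cancel])
  -- A block of indices and the union it indexes have the same size modulo `d`, so the residue
  -- condition transfers in both directions.
  have hmod : ∀ C ⊆ Icc 1 σ.1.parts.card, (C.biUnion g).card ≡ C.card [MOD d] := by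
    intro C hC
    rw [card_biUnion_of_bijOn hg hC]
    exact sum_modEq_card fun i hi => σ.2 _ (hg.mapsTo (hC hi))
  symm
  refine card_bij (fun ρ _ => ⟨coarsening hg ρ.1, fun s hs => ?_⟩) ?_ ?_ ?_
  · obtain ⟨C, hC, rfl⟩ := mem_image.1 hs
    exact (hmod C (ρ.1.subset hC)).trans (ρ.2 C hC)
  · intro ρ hρ
    rw [mem_filter] at hρ ⊢
    exact ⟨mem_univ _, le_coarsening hg ρ.1, (card_coarsening hg ρ.1).trans hρ.2⟩
  · intro ρ _ ρ' _ h
    exact Subtype.ext (coarsening_injective hg (congrArg Subtype.val h))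
  · intro τ hτ
    rw [mem_filter] at hτ
    have hle : σ.1 ≤ τ.1 := hτ.2.1
    refine ⟨⟨indexPartition hg hle, fun s hs => ?_⟩, mem_filter.2 ⟨mem_univ _, ?_⟩,
      Subtype.ext (coarsening_indexPartition hg hle)⟩
    · obtain ⟨B, hB, rfl⟩ := mem_image.1 hs
      have h1 := hmod (filter (g · ⊆ B) (Icc 1 σ.1.parts.card)) (filter_subset _ _)
      rw [biUnion_filter_subset_of_bijOn hg hle hB] at h1
      exact h1.symm.trans (τ.2 B hB)
    · rw [← hτ.2.2, ← card_coarsening hg (indexPartition hg hle), coarsening_indexPartition]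

/-! ### The recursion for the Möbius function. -/

section Moebius

variable {P : Type*} [PartialOrder P] [Fintype P] [OrderBot P]

lemma sum_moebius_bot [DecidableLE P] [DecidableEq P] (τ : P) :
    ∑ σ ∈ univ.filter (· ≤ τ), moebius P ⊥ σ = if τ = ⊥ then 1 else 0 := by
  classical
  let _ : LocallyFiniteOrder P := Fintype.toLocallyFiniteOrder
  have h := IncidenceAlgebra.sum_Icc_mu_right (𝕜 := ℤ) (⊥ : P) τ
  rw [show Icc ⊥ τ = univ.filter (· ≤ τ) by ext; simp] at h
  simp only [moebius, eq_comm (a := τ)]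
  convert h

/-- The values `μ(⊥, x)` are determined by the sums over lower sets. -/
lemma moebius_bot_eq [DecidableLE P] [DecidableEq P] {f : P → ℤ}
    (hf : ∀ τ, ∑ σ ∈ univ.filter (· ≤ τ), f σ = if τ = ⊥ then 1 else 0) (τ : P) :
    moebius P ⊥ τ = f τ := by
  induction τ using WellFoundedLT.induction with
  | ind τ ih =>
  have h := (sum_moebius_bot τ).trans (hf τ).symm
  have hmem : τ ∈ univ.filter (· ≤ τ) := by simp
  rw [← add_sum_erase _ _ hmem, ← add_sum_erase _ f hmem] at h
  have : ∑ x ∈ (univ.filter (· ≤ τ)).erase τ, moebius P ⊥ x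
      = ∑ x ∈ (univ.filter (· ≤ τ)).erase τ, f x :=
    sum_congr rfl fun x hx => ih x (lt_of_le_of_ne (by simpa using mem_of_mem_erase hx)
      (ne_of_mem_erase hx))
  rw [this] at h
  exact add_right_cancel h

end Moebius

/-! ### The Whitney numbers of the first kind as inverse Stirling numbers. -/

section Inverse

variable {d : ℕ}

open Classical in
/-- The sum of `μ(⊥, σ)` over the partitions `σ` with `j` parts. -/
noncomputable def moebiusSum (d m j : ℕ) : ℤ :=
  ∑ σ ∈ univ.filter (fun σ : PartitionPoset m d => σ.1.parts.card = j),
    moebius (PartitionPoset m d) ⊥ σ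

lemma eq_bot_of_card_parts (hd : 1 ≤ d) {n : ℕ} {τ : PartitionPoset n d} :
    τ.1.parts.card = n ↔ τ = ⊥ := by
  rw [← rank_eq_zero_iff hd]
  have h := card_parts_add_rank τ
  constructor
  · intro h'
    have : rank τ * d = 0 := by omega
    exact (mul_eq_zero.1 this).resolve_right (by omega)
  · intro h'
    rwa [h', zero_mul, add_zero] at h

lemma moebiusSum_eq_zero {m j : ℕ} (h : m < j) : moebiusSum d m j = 0 := by
  refine sum_eq_zero fun σ hσ => ?_
  have h1 := card_parts_le σ
  rw [mem_filter] at hσ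
  omega

lemma moebiusSum_zero {m : ℕ} (hm : 1 ≤ m) : moebiusSum d m 0 = 0 := by
  refine sum_eq_zero fun σ hσ => ?_
  have h1 := card_pos.2 (σ.1.parts_nonempty (by simp; omega))
  rw [mem_filter] at hσ
  omega

lemma stirling_eq_zero {m j : ℕ} (h : m < j) : stirling (progression d) m j = 0 := by
  rw [stirling_eq_card, card_eq_zero, filter_eq_empty_iff]
  intro σ _ hσ
  have := card_parts_le σ
  omega

/-- Write the Stirling number as the number of `τ ≥ σ` with `k` parts and exchange the sums. The
inner sum of `μ(⊥, σ)` over `σ ≤ τ` then vanishes unless `τ = ⊥`, which has `n` parts. -/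
lemma sum_moebiusSum_mul_stirling (hd : 1 ≤ d) (n k : ℕ) (hn : 1 ≤ n) :
    ∑ j ∈ Icc 1 n, moebiusSum d n j * stirling (progression d) j k
      = if n = k then 1 else 0 := by
  classical
  have hmaps : ∀ σ ∈ (univ : Finset (PartitionPoset n d)), σ.1.parts.card ∈ Icc 1 n := by
    intro σ _
    have := card_pos.2 (σ.1.parts_nonempty (by simp; omega))
    exact mem_Icc.2 ⟨this, card_parts_le σ⟩
  have h1 : ∑ j ∈ Icc 1 n, moebiusSum d n j * stirling (progression d) j k
      = ∑ σ : PartitionPoset n d, moebius (PartitionPoset n d) ⊥ σ *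
        stirling (progression d) σ.1.parts.card k := by
    rw [← sum_fiberwise_of_maps_to hmaps]
    refine sum_congr rfl fun j _ => ?_
    rw [moebiusSum, sum_mul]
    refine sum_congr rfl fun σ hσ => ?_
    rw [(mem_filter.1 hσ).2]
  rw [h1]
  have h2 : ∀ σ : PartitionPoset n d, moebius (PartitionPoset n d) ⊥ σ *
      stirling (progression d) σ.1.parts.card k
      = ∑ τ ∈ univ.filter (fun τ : PartitionPoset n d => τ.1.parts.card = k),
        if σ ≤ τ then moebius (PartitionPoset n d) ⊥ σ else 0 := by
    intro σ
    rw [← card_filter_le, ← sum_filter, filter_filter, sum_const, nsmul_eq_mul, mul_comm]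
    simp only [and_comm]
  simp only [h2]
  rw [sum_comm]
  simp only [← sum_filter]
  simp_rw [sum_moebius_bot]
  rw [sum_ite_eq']
  refine if_congr ?_ rfl rfl
  rw [mem_filter, (eq_bot_of_card_parts hd).2 rfl]
  exact and_iff_right (mem_univ _)

/-- The infinite matrix of the sums `moebiusSum d m j`. -/
noncomputable def moebiusMatrix (d : ℕ) : Matrix ℕ+ ℕ+ ℤ := fun m j => moebiusSum d m j

lemma lowerTriangular_moebiusMatrix : LowerTriangular (moebiusMatrix d) :=
  fun _ _ h => moebiusSum_eq_zero h

lemma lowerTriangular_stirlingMatrix : LowerTriangular (stirlingMatrix (progression d)) :=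
  fun _ _ h => by
    exact Nat.cast_eq_zero.2 (stirling_eq_zero h)

lemma moebiusMatrix_mul_stirlingMatrix (hd : 1 ≤ d) :
    MulEqOne (moebiusMatrix d) (stirlingMatrix (progression d)) := by
  rw [lowerTriangular_moebiusMatrix.mulEqOne_iff]
  intro n k
  have h := sum_moebiusSum_mul_stirling hd n k n.pos
  simp only [PNat.coe_inj] at h
  rw [← h]
  refine sum_bij (fun j _ => (j : ℕ)) ?_ ?_ ?_ ?_
  · intro j hj
    exact mem_Icc.2 ⟨j.pos, PNat.coe_le_coe _ _ |>.2 (mem_Iic.1 hj)⟩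
  · intro i _ j _ hij
    exact PNat.coe_injective hij
  · intro j hj
    rw [mem_Icc] at hj
    exact ⟨⟨j, hj.1⟩, mem_Iic.2 hj.2, rfl⟩
  · intro j _
    rfl

lemma existsUnique_isInverse (hd : 1 ≤ d) :
    ∃! B, IsInverse (stirlingMatrix (progression d)) B :=
  ⟨moebiusMatrix d,
    lowerTriangular_stirlingMatrix.isInverse lowerTriangular_moebiusMatrix
      (moebiusMatrix_mul_stirlingMatrix hd),
    fun _ hB => lowerTriangular_stirlingMatrix.eq_of_mulEqOne lowerTriangular_moebiusMatrix
      (moebiusMatrix_mul_stirlingMatrix hd) hB.1⟩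

lemma inverseStirling_eq (hd : 1 ≤ d) {n : ℕ} (hn : 1 ≤ n) (j : ℕ) :
    inverseStirling (progression d) n j = moebiusSum d n j := by
  rw [inverseStirling]
  split_ifs with h
  · rw [lowerTriangular_stirlingMatrix.inverseMatrix_eq lowerTriangular_moebiusMatrix
      (moebiusMatrix_mul_stirlingMatrix hd)]
    rfl
  · obtain rfl : j = 0 := by omega
    exact (moebiusSum_zero hn).symm

lemma whitneyFirst_eq {n : ℕ} (hn : 1 ≤ n) (hd : 1 ≤ d)
    [GradeMinOrder ℕ (PartitionPoset n d)] (k : ℕ) :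
    whitneyFirst (PartitionPoset n d) k = moebiusSum d n (n - k * d) := by
  rw [whitneyFirst, moebiusSum]
  refine sum_congr ?_ fun _ _ => rfl
  ext σ
  simp only [mem_filter, mem_univ, true_and, grade_eq_rank hd, rank_eq_iff hn hd]

end Inverse

/-! ### Good trees and their labels. -/

namespace PlaneTree

/-- The trees that occur in the forests of `goodForests d n k`. -/
def Good (d : ℕ) (T : PlaneTree) : Prop :=
  (T.NonLeavesBranch ∧ T.SiblingsIncrease) ∧ T.DegreesZeroOr (d + 1) ∧ T.LeftmostAreLeaves

variable {d : ℕ}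

lemma good_leaf (a : ℕ) : Good d (leaf a) := ⟨⟨trivial, trivial⟩, trivial, trivial⟩

lemma good_node_iff {m : ℕ} {c : Fin m → PlaneTree} :
    Good d (node m c) ↔ 2 ≤ m ∧ m = d + 1 ∧ (StrictMono fun i => (c i).maxLabel) ∧
      (∀ i, i.val = 0 → (c i).IsLeaf) ∧ ∀ i, Good d (c i) := by
  simp only [Good, NonLeavesBranch, SiblingsIncrease, DegreesZeroOr, LeftmostAreLeaves,
    forall_and]
  tauto

lemma mem_leafLabels_node {m : ℕ} {c : Fin m → PlaneTree} {x : ℕ} :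
    x ∈ (node m c).leafLabels ↔ ∃ i, x ∈ (c i).leafLabels := by
  simp [leafLabels, Multiset.mem_sum]

lemma maxLabel_le_maxLabel_node {m : ℕ} (c : Fin m → PlaneTree) (i : Fin m) :
    (c i).maxLabel ≤ (node m c).maxLabel := by
  rw [maxLabel]
  exact le_sup (f := fun i => (c i).maxLabel) (mem_univ i)

lemma exists_maxLabel_node_eq {m : ℕ} (hm : 0 < m) (c : Fin m → PlaneTree) :
    ∃ i, (node m c).maxLabel = (c i).maxLabel := by
  have : Nonempty (Fin m) := ⟨⟨0, hm⟩⟩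
  obtain ⟨i, -, hi⟩ := exists_mem_eq_sup univ univ_nonempty fun i => (c i).maxLabel
  exact ⟨i, by rw [maxLabel, hi]⟩

/-- Every non-leaf has children, so the supremum defining `maxLabel` is attained and never takes the
default value of an empty supremum. -/
lemma maxLabel_mem {T : PlaneTree} (hT : Good d T) : T.maxLabel ∈ T.leafLabels := by
  induction T with
  | leaf a => simp [maxLabel, leafLabels]
  | node m c ih =>
    rw [good_node_iff] at hT
    obtain ⟨i, hi⟩ := exists_maxLabel_node_eq (by omega) c
    rw [hi]
    exact mem_leafLabels_node.2 ⟨i, ih i (hT.2.2.2.2 i)⟩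

lemma card_leafLabels_pos {T : PlaneTree} (hT : Good d T) : 0 < T.leafLabels.card :=
  Multiset.card_pos_iff_exists_mem.2 ⟨_, maxLabel_mem hT⟩

lemma card_leafLabels_modEq {T : PlaneTree} (hT : Good d T) :
    T.leafLabels.card ≡ 1 [MOD d] := by
  induction T with
  | leaf a => simp [leafLabels, Nat.ModEq]
  | node m c ih =>
    rw [good_node_iff] at hT
    rw [leafLabels, Multiset.card_sum]
    refine (sum_modEq_card fun i _ => ih i (hT.2.2.2.2 i)).trans ?_
    rw [card_univ, Fintype.card_fin, hT.2.1]
    simp [Nat.ModEq]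

lemma card_leafLabels_lt {m : ℕ} {c : Fin m → PlaneTree} (hT : Good d (node m c)) (i : Fin m) :
    (c i).leafLabels.card < (node m c).leafLabels.card := by
  have hT' := good_node_iff.1 hT
  obtain ⟨j, hj⟩ : ∃ j : Fin m, j ≠ i := by
    have : Nontrivial (Fin m) := Fin.nontrivial_iff_two_le.2 hT'.1
    exact exists_ne i
  rw [leafLabels, Multiset.card_sum, ← add_sum_erase _ _ (mem_univ i),
    ← add_sum_erase _ _ (mem_erase.2 ⟨hj, mem_univ j⟩)]
  have := card_leafLabels_pos (hT'.2.2.2.2 j)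
  omega

/-- Induction on the number of leaves: a root has exactly `d + 1` subtrees, each with fewer leaves
than the whole tree. -/
lemma finite_good (d n N : ℕ) :
    {T : PlaneTree | Good d T ∧ T.leafLabels.card ≤ N ∧ ∀ x ∈ T.leafLabels, x ≤ n}.Finite := by
  induction N with
  | zero =>
    refine Set.finite_empty.subset fun T hT => ?_
    have := card_leafLabels_pos hT.1
    have := hT.2.1
    omega
  | succ N ih =>
    refine (((Set.finite_Iic n).image leaf).union
      ((Set.Finite.pi' fun _ : Fin (d + 1) => ih).image (node (d + 1)))).subset ?_
    rintro (a | ⟨m, c⟩) hT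
    · exact Or.inl ⟨a, hT.2.2 a (by simp [leafLabels]), rfl⟩
    · have h := good_node_iff.1 hT.1
      obtain rfl := h.2.1
      refine Or.inr ⟨c, fun i => ⟨h.2.2.2.2 i, ?_, fun x hx => ?_⟩, rfl⟩
      · have := card_leafLabels_lt hT.1 i
        have := hT.2.1
        omega
      · exact hT.2.2 x (mem_leafLabels_node.2 ⟨i, hx⟩)

/-- The set of leaf labels. -/
def labels (T : PlaneTree) : Finset ℕ := T.leafLabels.toFinset

lemma mem_labels {T : PlaneTree} {x : ℕ} : x ∈ T.labels ↔ x ∈ T.leafLabels :=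
  Multiset.mem_toFinset

lemma labels_subset_labels_node {m : ℕ} (c : Fin m → PlaneTree) (i : Fin m) :
    (c i).labels ⊆ (node m c).labels := fun _ hx =>
  mem_labels.2 (mem_leafLabels_node.2 ⟨i, mem_labels.1 hx⟩)

end PlaneTree

/-! ### Forests and their label partitions. -/

open PlaneTree

/-- A set of good trees whose leaves are labeled bijectively with `1, …, n`. -/
def IsForest (d n : ℕ) (F : Finset PlaneTree) : Prop :=
  ∑ T ∈ F, T.leafLabels = (Icc 1 n).val ∧ ∀ T ∈ F, Good d T

lemma mem_goodForests {d n k : ℕ} {F : Finset PlaneTree} :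
    F ∈ goodForests d n k ↔ IsForest d n F ∧ F.card = k := by
  simp only [goodForests, forests, IsForest, Good, Set.mem_ofPred_eq]
  constructor
  · rintro ⟨⟨h1, h2, h3⟩, h4⟩
    exact ⟨⟨h2, fun T hT => ⟨h3 T hT, h4 T hT⟩⟩, h1⟩
  · rintro ⟨⟨h1, h2⟩, h3⟩
    exact ⟨⟨h3, h1, fun T hT => (h2 T hT).1⟩, fun T hT => (h2 T hT).2⟩

namespace IsForest

variable {d n : ℕ} {F : Finset PlaneTree}

lemma leafLabels_le (hF : IsForest d n F) {T : PlaneTree} (hT : T ∈ F) :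
    T.leafLabels ≤ (Icc 1 n).val := by
  rw [← hF.1]
  exact single_le_sum (f := leafLabels) (fun _ _ => Multiset.zero_le _) hT

lemma nodup (hF : IsForest d n F) {T : PlaneTree} (hT : T ∈ F) : T.leafLabels.Nodup :=
  Multiset.nodup_of_le (hF.leafLabels_le hT) (Icc 1 n).nodup

lemma exists_mem (hF : IsForest d n F) {x : ℕ} (hx : x ∈ Icc 1 n) : ∃ T ∈ F, x ∈ T.labels := by
  have h : x ∈ (Icc 1 n).val := hx
  rw [← hF.1, Multiset.mem_sum] at h
  simpa only [mem_labels] using h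

lemma labels_subset (hF : IsForest d n F) {T : PlaneTree} (hT : T ∈ F) : T.labels ⊆ Icc 1 n :=
  fun _ hx => Multiset.mem_of_le (hF.leafLabels_le hT) (mem_labels.1 hx)

lemma labels_nonempty (hF : IsForest d n F) {T : PlaneTree} (hT : T ∈ F) : T.labels.Nonempty :=
  ⟨_, mem_labels.2 (maxLabel_mem (hF.2 T hT))⟩

lemma eq_of_mem (hF : IsForest d n F) {T T' : PlaneTree} (hT : T ∈ F) (hT' : T' ∈ F) {x : ℕ}
    (hx : x ∈ T.labels) (hx' : x ∈ T'.labels) : T = T' := by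
  classical
  by_contra hne
  have h := (Icc 1 n).nodup
  rw [← hF.1, ← add_sum_erase _ _ hT, ← add_sum_erase _ _ (mem_erase.2 ⟨Ne.symm hne, hT'⟩),
    ← add_assoc] at h
  have h1 := (Multiset.nodup_add.1 (Multiset.nodup_add.1 h).1).2.2
  exact Multiset.disjoint_left.1 h1 (mem_labels.1 hx) (mem_labels.1 hx')

lemma eq_of_maxLabel_eq (hF : IsForest d n F) {T T' : PlaneTree} (hT : T ∈ F) (hT' : T' ∈ F)
    (h : T.maxLabel = T'.maxLabel) : T = T' :=
  hF.eq_of_mem hT hT' (mem_labels.2 (maxLabel_mem (hF.2 T hT)))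
    (h ▸ mem_labels.2 (maxLabel_mem (hF.2 T' hT')))

lemma labels_injOn (hF : IsForest d n F) : Set.InjOn labels F := by
  intro T hT T' hT' h
  obtain ⟨x, hx⟩ := hF.labels_nonempty hT
  exact hF.eq_of_mem hT hT' hx (h ▸ hx)

/-- The partition of `{1, …, n}` into the label sets of the trees of a forest. -/
def labelPartition (hF : IsForest d n F) : PartitionPoset n d :=
  ⟨Finpartition.ofExistsUnique (F.image labels)
    (by
      intro p hp
      obtain ⟨T, hT, rfl⟩ := mem_image.1 hp
      exact hF.labels_subset hT)
    (by
      intro x hx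
      obtain ⟨T, hT, hxT⟩ := hF.exists_mem hx
      refine ⟨_, ⟨mem_image_of_mem _ hT, hxT⟩, ?_⟩
      rintro C ⟨hC, hxC⟩
      obtain ⟨T', hT', rfl⟩ := mem_image.1 hC
      rw [hF.eq_of_mem hT' hT hxC hxT])
    (by
      intro h
      obtain ⟨T, hT, h0⟩ := mem_image.1 h
      exact (hF.labels_nonempty hT).ne_empty h0),
  by
    intro s hs
    obtain ⟨T, hT, rfl⟩ := mem_image.1 hs
    rw [labels, Multiset.toFinset_card_of_nodup (hF.nodup hT)]
    exact card_leafLabels_modEq (hF.2 T hT)⟩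

lemma labelPartition_parts (hF : IsForest d n F) :
    hF.labelPartition.1.parts = F.image labels := rfl

lemma card_labelPartition (hF : IsForest d n F) :
    hF.labelPartition.1.parts.card = F.card := by
  rw [labelPartition_parts, card_image_of_injOn hF.labels_injOn]

lemma labelPartition_le_iff (hF : IsForest d n F) {τ : PartitionPoset n d} :
    hF.labelPartition ≤ τ ↔ ∀ T ∈ F, ∃ B ∈ τ.1.parts, T.labels ⊆ B := by
  constructor
  · intro h T hT
    exact h (mem_image_of_mem labels hT)
  · intro h A hA
    obtain ⟨T, hT, rfl⟩ := mem_image.1 hA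
    exact h T hT

lemma filter_labelPartition (hF : IsForest d n F) (B : Finset ℕ) :
    hF.labelPartition.1.parts.filter (· ⊆ B) = (F.filter (labels · ⊆ B)).image labels := by
  rw [labelPartition_parts, filter_image]

end IsForest

/-- The forests of good trees with leaves labeled `1, …, n`. -/
abbrev Forest (n d : ℕ) : Type := {F : Finset PlaneTree // IsForest d n F}

instance (n d : ℕ) : Finite (Forest n d) := by
  have h := finite_good d n n
  refine Set.Finite.subset (s := {F : Finset PlaneTree | F ⊆ h.toFinset})
    (h.toFinset.powerset.finite_toSet.subset fun F hF => ?_) fun F hF T hT => ?_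
  · exact mem_coe.2 (mem_powerset.2 hF)
  · have hF : IsForest d n F := hF
    rw [h.mem_toFinset]
    refine ⟨hF.2 T hT, ?_, fun x hx => (mem_Icc.1 (hF.labels_subset hT (mem_labels.2 hx))).2⟩
    simpa using Multiset.card_le_card (hF.leafLabels_le hT)

noncomputable instance (n d : ℕ) : Fintype (Forest n d) := Fintype.ofFinite _

/-- Only the forest of single leaves has the discrete label partition. -/
lemma labelPartition_eq_bot_iff {n d : ℕ} [DecidableEq PlaneTree] (F : Forest n d) :
    F.2.labelPartition = ⊥ ↔ F.1 = (Icc 1 n).image leaf := by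
  constructor
  · intro h
    have hleaf : ∀ T ∈ F.1, ∃ a, T = leaf a := by
      intro T hT
      have h1 : T.labels ∈ F.2.labelPartition.1.parts := mem_image_of_mem labels hT
      rw [h] at h1
      obtain ⟨a, -, ha⟩ := Finpartition.mem_bot_iff.1 h1
      have h2 : T.leafLabels.card = 1 := by
        rw [← Multiset.toFinset_card_of_nodup (F.2.nodup hT)]
        change T.labels.card = 1
        rw [← ha, card_singleton]
      cases T with
      | leaf a => exact ⟨a, rfl⟩
      | node m c =>
        have h3 := good_node_iff.1 (F.2.2 _ hT)
        have h4 := card_leafLabels_lt (F.2.2 _ hT) ⟨0, by omega⟩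
        have h5 := card_leafLabels_pos (h3.2.2.2.2 ⟨0, by omega⟩)
        omega
    ext T
    rw [mem_image]
    constructor
    · intro hT
      obtain ⟨a, rfl⟩ := hleaf T hT
      exact ⟨a, F.2.labels_subset hT (mem_labels.2 (by simp [leafLabels])), rfl⟩
    · rintro ⟨a, ha, rfl⟩
      obtain ⟨T, hT, haT⟩ := F.2.exists_mem ha
      obtain ⟨b, rfl⟩ := hleaf T hT
      rw [mem_labels, leafLabels, Multiset.mem_singleton] at haT
      rwa [haT]
  · intro h
    rw [← le_bot_iff, F.2.labelPartition_le_iff, h]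
    intro T hT
    obtain ⟨a, ha, rfl⟩ := mem_image.1 hT
    exact ⟨{a}, Finpartition.mem_bot_iff.2 ⟨a, ha, rfl⟩, by simp [labels, leafLabels]⟩

lemma isForest_image_leaf (n d : ℕ) [DecidableEq PlaneTree] :
    IsForest d n ((Icc 1 n).image leaf) := by
  constructor
  · rw [sum_image fun a _ b _ h => leaf.inj h]
    simp only [leafLabels]
    exact sum_multiset_singleton _
  · intro T hT
    obtain ⟨a, -, rfl⟩ := mem_image.1 hT
    exact good_leaf a

/-! ### Breaking and joining trees. -/

/-- Two increasing enumerations of initial segments of the same length agree. -/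
lemma eq_of_initial {ι : Type*} {κ : ι → ℕ} {X : Set ι} (hκ : Set.InjOn κ X) {m : ℕ}
    {c c' : Fin m → ι} (hc : StrictMono fun i => κ (c i)) (hc' : StrictMono fun i => κ (c' i))
    (hX : ∀ i, c i ∈ X) (hX' : ∀ i, c' i ∈ X)
    (hl : ∀ i, ∀ x ∈ X, κ x ≤ κ (c i) → ∃ j, x = c j)
    (hl' : ∀ i, ∀ x ∈ X, κ x ≤ κ (c' i) → ∃ j, x = c' j) : c = c' := by
  funext i
  induction i using WellFoundedLT.induction with
  | ind i ih =>
  refine hκ (hX i) (hX' i) ?_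
  rcases lt_trichotomy (κ (c i)) (κ (c' i)) with h | h | h
  -- The element with the smaller key appears in the other enumeration at an earlier index `j < i`.
  -- By induction both enumerations agree at `j`, so one of them would repeat a value.
  · obtain ⟨j, hj⟩ := hl' i (c i) (hX i) h.le
    rw [hj] at h
    have hji : j < i := hc'.lt_iff_lt.1 h
    rw [← ih j hji] at hj
    exact absurd (hc.injective (congrArg κ hj)) hji.ne'
  · exact h
  · obtain ⟨j, hj⟩ := hl i (c' i) (hX' i) h.le
    rw [hj] at h
    have hji : j < i := hc.lt_iff_lt.1 h
    rw [ih j hji] at hj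
    exact absurd (hc'.injective (congrArg κ hj)) hji.ne'

lemma exists_initial {ι : Type*} {κ : ι → ℕ} (X : Finset ι) (hκ : Set.InjOn κ X) {m : ℕ}
    (hm : m ≤ X.card) : ∃ c : Fin m → ι, (StrictMono fun i => κ (c i)) ∧ (∀ i, c i ∈ X) ∧
      ∀ i, ∀ x ∈ X, κ x ≤ κ (c i) → ∃ j, x = c j := by
  have hK : (X.image κ).card = X.card := card_image_of_injOn hκ
  let e := (X.image κ).orderEmbOfFin hK
  have he : ∀ i : Fin m, ∃ x ∈ X, κ x = e (Fin.castLE hm i) := fun i =>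
    mem_image.1 ((X.image κ).orderEmbOfFin_mem hK _)
  choose c hc hce using he
  refine ⟨c, ?_, hc, ?_⟩
  · intro i j hij
    simp only [hce]
    exact e.strictMono (Fin.castLE_lt_castLE_iff hm |>.2 hij)
  · intro i x hx hxi
    obtain ⟨j, hj⟩ : κ x ∈ Set.range e := by
      rw [range_orderEmbOfFin]
      exact mem_coe.2 (mem_image_of_mem κ hx)
    rw [hce, ← hj, e.le_iff_le] at hxi
    have hjm : j.val < m := lt_of_le_of_lt (Fin.le_def.1 hxi) i.2
    refine ⟨⟨j, hjm⟩, hκ hx (hc _) ?_⟩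
    rw [hce, ← hj]
    rfl

/-- Among the trees of `F` with labels in `B`, the tree `T` has the least maximal label. -/
def IsFirst (B : Finset ℕ) (F : Finset PlaneTree) (T : PlaneTree) : Prop :=
  T ∈ F ∧ T.labels ⊆ B ∧ ∀ T' ∈ F, T'.labels ⊆ B → T.maxLabel ≤ T'.maxLabel

open Classical in
/-- The forest `F'` arises from `F` by breaking up its first tree with labels in `B`. -/
def Breaks (d : ℕ) (B : Finset ℕ) (F F' : Finset PlaneTree) : Prop :=
  ∃ (G : Finset PlaneTree) (c : Fin (d + 1) → PlaneTree),
    (StrictMono fun i => (c i).maxLabel) ∧ node (d + 1) c ∉ G ∧ Disjoint G (univ.image c) ∧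
    F = insert (node (d + 1) c) G ∧ F' = G ∪ univ.image c ∧ IsFirst B F (node (d + 1) c)

section Breaks

variable {d n : ℕ} {B : Finset ℕ} {F F' : Finset PlaneTree}

lemma IsFirst.eq (hF : IsForest d n F) {T T' : PlaneTree} (h : IsFirst B F T)
    (h' : IsFirst B F T') : T = T' :=
  hF.eq_of_maxLabel_eq h.1 h'.1 ((h.2.2 T' h'.1 h'.2.1).antisymm (h'.2.2 T h.1 h.2.1))

lemma exists_isFirst (h : ∃ T ∈ F, T.labels ⊆ B) : ∃ T, IsFirst B F T := by
  obtain ⟨T, hT, hmin⟩ := exists_min_image (F.filter (labels · ⊆ B)) maxLabel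
    (let ⟨T, hT, hTB⟩ := h; ⟨T, mem_filter.2 ⟨hT, hTB⟩⟩)
  rw [mem_filter] at hT
  exact ⟨T, hT.1, hT.2, fun T' hT' hB => hmin T' (mem_filter.2 ⟨hT', hB⟩)⟩

lemma sum_leafLabels_replace [DecidableEq PlaneTree] {m : ℕ} {G : Finset PlaneTree}
    {c : Fin m → PlaneTree} (hc : StrictMono fun i => (c i).maxLabel) (hG : node m c ∉ G)
    (hdisj : Disjoint G (univ.image c)) :
    ∑ T ∈ insert (node m c) G, T.leafLabels = ∑ T ∈ G ∪ univ.image c, T.leafLabels := by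
  have hinj : Function.Injective c := fun i j h => hc.injective (congrArg maxLabel h)
  rw [sum_insert hG, sum_union hdisj, sum_image hinj.injOn, add_comm, leafLabels]

/-- One tree is replaced by `d + 1`, which lowers the rank by one and flips the sign. -/
lemma Breaks.card_eq (h : Breaks d B F F') : F'.card = F.card + d := by
  classical
  obtain ⟨G, c, hc, hG, hdisj, rfl, rfl, -⟩ := h
  have hinj : Function.Injective c := fun i j h => hc.injective (congrArg maxLabel h)
  rw [card_insert_of_notMem hG, card_union_of_disjoint, card_image_of_injective _ hinj, card_univ,
    Fintype.card_fin]
  · ring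
  · convert hdisj

lemma Breaks.right_unique {F'' : Finset PlaneTree} (hF : IsForest d n F) (h : Breaks d B F F')
    (h' : Breaks d B F F'') : F' = F'' := by
  classical
  obtain ⟨G, c, hc, hG, hdisj, hFG, rfl, hfirst⟩ := h
  obtain ⟨G', c', hc', hG', hdisj', hFG', rfl, hfirst'⟩ := h'
  have hT := hfirst.eq hF hfirst'
  obtain rfl : c = c' := by injection hT
  have : G = G' := by
    rw [← erase_insert hG, ← erase_insert hG', ← hFG, ← hFG']
  rw [this]

/-- The children can be recognized in `F'`: they are the `d + 1` trees inside `B` with least maximal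
labels, because every other tree inside `B` has a larger maximal label than the broken tree. -/
lemma Breaks.left_unique {F'' : Finset PlaneTree} (hF : IsForest d n F) (hF'' : IsForest d n F'')
    (hF' : IsForest d n F') (h : Breaks d B F F') (h' : Breaks d B F'' F') : F = F'' := by
  classical
  have key : ∀ (F G : Finset PlaneTree) (c : Fin (d + 1) → PlaneTree), IsForest d n F →
      node (d + 1) c ∉ G → F = insert (node (d + 1) c) G → F' = G ∪ univ.image c →
      IsFirst B F (node (d + 1) c) → (∀ i, c i ∈ {T | T ∈ F' ∧ T.labels ⊆ B}) ∧
      ∀ i, ∀ T ∈ {T | T ∈ F' ∧ T.labels ⊆ B}, T.maxLabel ≤ (c i).maxLabel → ∃ j, T = c j := by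
    rintro F G c hF hG rfl rfl hfirst
    refine ⟨fun i => ⟨mem_union_right _ (mem_image_of_mem c (mem_univ i)),
      (labels_subset_labels_node c i).trans hfirst.2.1⟩, ?_⟩
    rintro i T ⟨hT, hTB⟩ hle
    rcases mem_union.1 hT with hT | hT
    · have h1 := hfirst.2.2 T (mem_insert_of_mem hT) hTB
      have h2 := maxLabel_le_maxLabel_node c i
      have h3 := hF.eq_of_maxLabel_eq (mem_insert_of_mem hT) (mem_insert_self _ _)
        ((hle.trans h2).antisymm h1)
      exact absurd (h3 ▸ hT) hG
    · obtain ⟨j, -, rfl⟩ := mem_image.1 hT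
      exact ⟨j, rfl⟩
  obtain ⟨G, c, hc, hG, hdisj, hFG, hF'G, hfirst⟩ := h
  obtain ⟨G', c', hc', hG', hdisj', hFG', hF'G', hfirst'⟩ := h'
  obtain ⟨hX, hl⟩ := key F G c hF hG hFG (by convert hF'G) hfirst
  obtain ⟨hX', hl'⟩ := key F'' G' c' hF'' hG' hFG' (by convert hF'G') hfirst'
  obtain rfl : c = c' := eq_of_initial
    (fun T hT T' hT' h => hF'.eq_of_maxLabel_eq hT.1 hT'.1 h) hc hc' hX hX' hl hl'
  have : G = G' := by
    rw [← union_sdiff_cancel_right hdisj, ← union_sdiff_cancel_right hdisj', ← hF'G, ← hF'G']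
  rw [hFG, hFG', this]

variable {τ : PartitionPoset n d}

/-- After the break the left-most child, which is a leaf, has the least maximal label inside `B`. So
the new forest falls in the case where the first tree is a leaf. -/
lemma exists_breaks (hF : IsForest d n F) (hle : hF.labelPartition ≤ τ) {T : PlaneTree}
    (hB : B ∈ τ.1.parts) (hT : IsFirst B F T) (hleaf : ¬T.IsLeaf) :
    ∃ (F' : Finset PlaneTree) (hF' : IsForest d n F'), hF'.labelPartition ≤ τ ∧
      (∃ T', IsFirst B F' T' ∧ T'.IsLeaf) ∧ Breaks d B F F' := by
  classical
  rw [hF.labelPartition_le_iff] at hle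
  cases T with
  | leaf a => exact absurd trivial hleaf
  | node m c =>
  have hgood := good_node_iff.1 (hF.2 _ hT.1)
  obtain ⟨hm, rfl, hc, hc0, hcg⟩ := hgood
  have hdisj : Disjoint (F.erase (node (d + 1) c)) (univ.image c) := by
    rw [Finset.disjoint_left]
    intro T' hT' hT''
    obtain ⟨i, -, rfl⟩ := mem_image.1 hT''
    rw [mem_erase] at hT'
    obtain ⟨x, hx⟩ := hF.labels_nonempty hT'.2
    exact hT'.1 (hF.eq_of_mem hT'.2 hT.1 hx (labels_subset_labels_node c i hx))
  have hF' : IsForest d n (F.erase (node (d + 1) c) ∪ univ.image c) := by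
    constructor
    · rw [← sum_leafLabels_replace hc (notMem_erase _ _) hdisj, insert_erase hT.1]
      exact hF.1
    · intro T' hT'
      rcases mem_union.1 hT' with hT' | hT'
      · exact hF.2 T' (mem_of_mem_erase hT')
      · obtain ⟨i, -, rfl⟩ := mem_image.1 hT'
        exact hcg i
  refine ⟨_, hF', hF'.labelPartition_le_iff.2 ?_, ⟨c 0, ⟨?_, ?_, ?_⟩, hc0 0 rfl⟩,
    F.erase (node (d + 1) c), c, hc, notMem_erase _ _, by convert hdisj,
    by convert (insert_erase hT.1).symm, by congr!, hT⟩
  · intro T' hT'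
    rcases mem_union.1 hT' with hT' | hT'
    · exact hle T' (mem_of_mem_erase hT')
    · obtain ⟨i, -, rfl⟩ := mem_image.1 hT'
      exact ⟨B, hB, (labels_subset_labels_node c i).trans hT.2.1⟩
  · exact mem_union_right _ (mem_image_of_mem c (mem_univ 0))
  · exact (labels_subset_labels_node c 0).trans hT.2.1
  · intro T' hT' hT'B
    rcases mem_union.1 hT' with hT' | hT'
    · exact (maxLabel_le_maxLabel_node c 0).trans (hT.2.2 T' (mem_of_mem_erase hT') hT'B)
    · obtain ⟨i, -, rfl⟩ := mem_image.1 hT'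
      exact hc.monotone (Fin.zero_le i)

lemma card_filter_labels_modEq (hF : IsForest d n F) (hle : hF.labelPartition ≤ τ)
    (hB : B ∈ τ.1.parts) : (F.filter (labels · ⊆ B)).card ≡ 1 [MOD d] := by
  have h := card_parts_filter_modEq hle hB
  rwa [hF.filter_labelPartition, card_image_of_injOn] at h
  exact hF.labels_injOn.mono (coe_subset.2 (filter_subset _ _))

lemma exists_labels_subset (hF : IsForest d n F) (hle : hF.labelPartition ≤ τ)
    (hB : B ∈ τ.1.parts) : ∃ T ∈ F, T.labels ⊆ B := by
  obtain ⟨A, hA⟩ := filter_subset_nonempty hle hB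
  rw [hF.filter_labelPartition] at hA
  obtain ⟨T, hT, -⟩ := mem_image.1 hA
  exact ⟨T, mem_filter.1 hT⟩

/-- The count is 1 modulo `d`. If it were 1, the leaf `T` alone would carry all labels of `B`, which
has at least two. -/
lemma le_card_filter_labels (hF : IsForest d n F) (hle : hF.labelPartition ≤ τ)
    (hB : B ∈ τ.1.parts) (hB2 : 2 ≤ B.card) {T : PlaneTree} (hT : IsFirst B F T)
    (hleaf : T.IsLeaf) : d + 1 ≤ (F.filter (labels · ⊆ B)).card := by
  by_contra! hlt
  have hTm : T ∈ F.filter (labels · ⊆ B) := mem_filter.2 ⟨hT.1, hT.2.1⟩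
  have h1 : 0 < (F.filter (labels · ⊆ B)).card := card_pos.2 ⟨T, hTm⟩
  have h2 := (Nat.modEq_iff_dvd' h1).1 (card_filter_labels_modEq hF hle hB).symm
  have h3 := Nat.eq_zero_of_dvd_of_lt h2 (by omega)
  obtain ⟨T', hT'⟩ := card_eq_one.1 (show (F.filter (labels · ⊆ B)).card = 1 by omega)
  have h4 := biUnion_filter_subset hle hB
  rw [hF.filter_labelPartition, hT'] at h4
  rw [hT', mem_singleton] at hTm
  subst hTm
  cases T with
  | node m c => exact hleaf
  | leaf a =>
    simp [labels, leafLabels] at h4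
    rw [← h4, card_singleton] at hB2
    omega

/-- Joining the `d + 1` trees with least maximal labels puts the leaf `T₀` left-most, so the new
tree is good. Its maximal label is that of its last child, hence below those of the remaining trees
inside `B`, and it becomes the first tree. -/
lemma exists_breaks_of_isLeaf (hd : 1 ≤ d) (hF' : IsForest d n F')
    (hle : hF'.labelPartition ≤ τ)
    {T₀ : PlaneTree} (hB : B ∈ τ.1.parts) (hB2 : 2 ≤ B.card) (hT₀ : IsFirst B F' T₀)
    (hleaf : T₀.IsLeaf) :
    ∃ (F : Finset PlaneTree) (hF : IsForest d n F), hF.labelPartition ≤ τ ∧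
      (∃ T, IsFirst B F T ∧ ¬T.IsLeaf) ∧ Breaks d B F F' := by
  classical
  obtain ⟨c, hc, hcX, hcl⟩ := exists_initial (κ := maxLabel) (F'.filter (labels · ⊆ B))
    (fun T hT T' hT' h => hF'.eq_of_maxLabel_eq (mem_filter.1 (mem_coe.1 hT)).1
      (mem_filter.1 (mem_coe.1 hT')).1 h) (le_card_filter_labels hF' hle hB hB2 hT₀ hleaf)
  simp only [mem_filter] at hcX hcl
  rw [hF'.labelPartition_le_iff] at hle
  have hDF : univ.image c ⊆ F' := by
    intro T hT
    obtain ⟨i, -, rfl⟩ := mem_image.1 hT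
    exact (hcX i).1
  have hdisj : Disjoint (F' \ univ.image c) (univ.image c) := sdiff_disjoint
  have hF'eq : F' = F' \ univ.image c ∪ univ.image c := (sdiff_union_of_subset hDF).symm
  have hc0 : (c 0).IsLeaf := by
    obtain ⟨j, rfl⟩ := hcl 0 T₀ ⟨hT₀.1, hT₀.2.1⟩ (hT₀.2.2 _ (hcX 0).1 (hcX 0).2)
    have : j ≤ 0 := hc.le_iff_le.1 (hT₀.2.2 _ (hcX 0).1 (hcX 0).2)
    rwa [← Fin.le_zero_iff.1 this]
  have hgood : Good d (node (d + 1) c) := good_node_iff.2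
    ⟨by omega, rfl, hc, fun i hi => by rwa [show i = 0 from Fin.ext hi],
      fun i => hF'.2 _ (hcX i).1⟩
  have hG : node (d + 1) c ∉ F' \ univ.image c := by
    intro h
    obtain ⟨x, hx⟩ := hF'.labels_nonempty (hcX 0).1
    have h1 := hF'.eq_of_mem (mem_sdiff.1 h).1 (hcX 0).1 (labels_subset_labels_node c 0 hx) hx
    exact (mem_sdiff.1 h).2 (h1 ▸ mem_image_of_mem c (mem_univ 0))
  have hlabels : (node (d + 1) c).labels ⊆ B := by
    intro x hx
    obtain ⟨i, hi⟩ := mem_leafLabels_node.1 (mem_labels.1 hx)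
    exact (hcX i).2 (mem_labels.2 hi)
  have hF : IsForest d n (insert (node (d + 1) c) (F' \ univ.image c)) := by
    constructor
    · rw [sum_leafLabels_replace hc hG hdisj, ← hF'eq]
      exact hF'.1
    · intro T hT
      rcases mem_insert.1 hT with rfl | hT
      · exact hgood
      · exact hF'.2 T (mem_sdiff.1 hT).1
  have hfirst : IsFirst B (insert (node (d + 1) c) (F' \ univ.image c)) (node (d + 1) c) := by
    refine ⟨mem_insert_self _ _, hlabels, ?_⟩
    intro T hT hTB
    rcases mem_insert.1 hT with rfl | hT
    · exact le_rfl
    · rw [mem_sdiff] at hT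
      by_contra! hlt
      obtain ⟨i, hi⟩ := exists_maxLabel_node_eq (by omega) c
      obtain ⟨j, rfl⟩ := hcl i T ⟨hT.1, hTB⟩ (hi ▸ hlt.le)
      exact hT.2 (mem_image_of_mem c (mem_univ j))
  refine ⟨_, hF, hF.labelPartition_le_iff.2 ?_, ⟨_, hfirst, fun h => h⟩,
    F' \ univ.image c, c, hc, ?_, ?_, ?_, ?_, hfirst⟩
  · intro T hT
    rcases mem_insert.1 hT with rfl | hT
    · exact ⟨B, hB, hlabels⟩
    · exact hle T (mem_sdiff.1 hT).1
  · convert hG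
  · convert hdisj
  · congr!
  · convert hF'eq

end Breaks

/-! ### Signed counts of forests and the Möbius function. -/

section SignedCount

variable {n d : ℕ}

lemma card_add_rank (F : Forest n d) : F.1.card + rank F.2.labelPartition * d = n := by
  rw [← F.2.card_labelPartition]
  exact card_parts_add_rank _

/-- The signed count of the forests refining a non-discrete partition vanishes, by breaking up and
merging the first tree in a fixed non-trivial part. -/
lemma sum_sign_eq_zero (hd : 1 ≤ d) {τ : PartitionPoset n d} (hτ : τ ≠ ⊥)
    [DecidableLE (PartitionPoset n d)] :
    ∑ F ∈ univ.filter (fun F : Forest n d => F.2.labelPartition ≤ τ),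
      (-1 : ℤ) ^ rank F.2.labelPartition = 0 := by
  classical
  obtain ⟨B, hB, hB2⟩ : ∃ B ∈ τ.1.parts, 2 ≤ B.card := by
    obtain ⟨B, hB, h⟩ := exists_part_of_lt (bot_lt_iff_ne_bot.2 hτ)
    refine ⟨B, hB, ?_⟩
    rw [card_eq_sum_filter_subset (bot_le : (⊥ : Finpartition (Icc 1 n)) ≤ τ.1) hB]
    refine le_trans (b := ((⊥ : Finpartition (Icc 1 n)).parts.filter (· ⊆ B)).card)
      (le_trans (by omega) h) ?_
    rw [card_eq_sum_ones]
    exact sum_le_sum fun A hA =>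
      card_pos.2 ((⊥ : Finpartition (Icc 1 n)).nonempty_of_mem_parts (mem_filter.1 hA).1)
  let X := univ.filter fun F : Forest n d => F.2.labelPartition ≤ τ
  -- Breaking matches the forests satisfying `q` with those whose first tree inside `B` is a leaf.
  let q : Forest n d → Prop := fun F => ∃ T, IsFirst B F.1 T ∧ ¬T.IsLeaf
  have hbreak : ∀ F ∈ X.filter q, ∃ F' ∈ X.filter (¬q ·), Breaks d B F.1 F'.1 := by
    intro F hF
    simp only [X, q, mem_filter, mem_univ, true_and] at hF
    obtain ⟨hle, T, hT, hleaf⟩ := hF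
    obtain ⟨F', hF', hle', ⟨T', hT', hleaf'⟩, hb⟩ := exists_breaks F.2 hle hB hT hleaf
    refine ⟨⟨F', hF'⟩, ?_, hb⟩
    simp only [X, q, mem_filter, mem_univ, true_and, not_exists, not_and, not_not]
    refine ⟨hle', fun T hT => ?_⟩
    rwa [hT.eq hF' hT']
  choose! f hf hfb using hbreak
  have hbij : ∑ F ∈ X.filter q, (-1 : ℤ) ^ rank F.2.labelPartition
      = ∑ F ∈ X.filter (¬q ·), -(-1 : ℤ) ^ rank F.2.labelPartition := by
    refine sum_bij (fun F _ => f F) hf ?_ ?_ ?_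
    · intro F₁ h₁ F₂ h₂ h
      exact Subtype.ext (Breaks.left_unique F₁.2 F₂.2 (f F₁).2 (hfb F₁ h₁) (h ▸ hfb F₂ h₂))
    · intro F' hF'
      simp only [X, q, mem_filter, mem_univ, true_and, not_exists, not_and, not_not] at hF'
      obtain ⟨hle, hall⟩ := hF'
      obtain ⟨T₀, hT₀⟩ := exists_isFirst (exists_labels_subset F'.2 hle hB)
      obtain ⟨F, hF, hleF, hq, hb⟩ :=
        exists_breaks_of_isLeaf hd F'.2 hle hB hB2 hT₀ (hall T₀ hT₀)
      have hmem : (⟨F, hF⟩ : Forest n d) ∈ X.filter q := by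
        simp only [X, q, mem_filter, mem_univ, true_and]
        exact ⟨hleF, hq⟩
      exact ⟨⟨F, hF⟩, hmem, Subtype.ext (Breaks.right_unique hF (hfb _ hmem) hb)⟩
    · intro F hF
      have h1 := card_add_rank F
      have h2 := card_add_rank (f F)
      have h3 := (hfb F hF).card_eq
      have h4 : rank F.2.labelPartition = rank (f F).2.labelPartition + 1 := by
        refine Nat.eq_of_mul_eq_mul_right hd ?_
        rw [add_mul]
        omega
      rw [h4, pow_succ]
      ring
  change ∑ F ∈ X, _ = _
  rw [← sum_filter_add_sum_filter_not X q, hbij, sum_neg_distrib, neg_add_cancel]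

lemma sum_sign (hd : 1 ≤ d) (τ : PartitionPoset n d) [DecidableLE (PartitionPoset n d)]
    [DecidableEq (PartitionPoset n d)] :
    ∑ F ∈ univ.filter (fun F : Forest n d => F.2.labelPartition ≤ τ),
      (-1 : ℤ) ^ rank F.2.labelPartition = if τ = ⊥ then 1 else 0 := by
  classical
  split_ifs with h
  · subst h
    have : univ.filter (fun F : Forest n d => F.2.labelPartition ≤ ⊥)
        = {⟨_, isForest_image_leaf n d⟩} := by
      ext F
      rw [mem_filter, mem_singleton, le_bot_iff, labelPartition_eq_bot_iff, Subtype.ext_iff]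
      exact and_iff_right (mem_univ _)
    rw [this, sum_singleton, (labelPartition_eq_bot_iff _).2 rfl, rank_bot, pow_zero]
  · exact sum_sign_eq_zero hd h

/-- The Möbius function counts the forests with a given label partition, up to sign. -/
lemma moebius_bot_eq_sum (hd : 1 ≤ d) (τ : PartitionPoset n d)
    [DecidableEq (PartitionPoset n d)] :
    moebius (PartitionPoset n d) ⊥ τ
      = ∑ F ∈ univ.filter (fun F : Forest n d => F.2.labelPartition = τ),
        (-1 : ℤ) ^ rank F.2.labelPartition := by
  classical
  refine moebius_bot_eq (f := fun τ => ∑ F ∈ univ.filter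
    (fun F : Forest n d => F.2.labelPartition = τ), (-1 : ℤ) ^ rank F.2.labelPartition)
    (fun τ => ?_) τ
  rw [← sum_sign hd τ, ← sum_fiberwise_of_maps_to
    (s := univ.filter fun F : Forest n d => F.2.labelPartition ≤ τ)
    (t := univ.filter (· ≤ τ)) (g := fun F => F.2.labelPartition)
    fun F hF => mem_filter.2 ⟨mem_univ _, (mem_filter.1 hF).2⟩]
  refine sum_congr rfl fun σ hσ => sum_congr ?_ fun _ _ => rfl
  ext F
  simp only [mem_filter, mem_univ, true_and] at hσ ⊢
  exact ⟨fun h => ⟨h ▸ hσ, h⟩, fun h => h.2⟩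

lemma goodForests_eq (d n j : ℕ) :
    goodForests d n j
      = Subtype.val '' {F : Forest n d | F.2.labelPartition.1.parts.card = j} := by
  ext F
  rw [mem_goodForests]
  constructor
  · rintro ⟨hF, hj⟩
    exact ⟨⟨F, hF⟩, hF.card_labelPartition.trans hj, rfl⟩
  · rintro ⟨F, hF, rfl⟩
    exact ⟨F.2, F.2.card_labelPartition.symm.trans hF⟩

lemma finite_goodForests (d n j : ℕ) : (goodForests d n j).Finite := by
  rw [goodForests_eq]
  exact (Set.toFinite _).image _

lemma moebiusSum_eq (hn : 1 ≤ n) (hd : 1 ≤ d) (k : ℕ) :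
    moebiusSum d n (n - k * d) = (-1) ^ k * ((goodForests d n (n - k * d)).ncard : ℤ) := by
  classical
  have h1 : (goodForests d n (n - k * d)).ncard
      = (univ.filter fun F : Forest n d =>
        F.2.labelPartition.1.parts.card = n - k * d).card := by
    rw [goodForests_eq, Set.ncard_image_of_injective _ Subtype.val_injective,
      ← Set.ncard_coe_finset, coe_filter_univ]
  rw [h1, moebiusSum]
  simp only [moebius_bot_eq_sum hd]
  rw [card_eq_sum_ones, Nat.cast_sum, mul_sum, ← sum_fiberwise_of_maps_to
    (s := univ.filter fun F : Forest n d => F.2.labelPartition.1.parts.card = n - k * d)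
    (t := univ.filter fun σ : PartitionPoset n d => σ.1.parts.card = n - k * d)
    (g := fun F => F.2.labelPartition)
    fun F hF => mem_filter.2 ⟨mem_univ _, (mem_filter.1 hF).2⟩]
  refine sum_congr (by congr!) fun σ hσ => sum_congr ?_ fun F hF => ?_
  · ext F
    simp only [mem_filter, mem_univ, true_and] at hσ ⊢
    exact ⟨fun h => ⟨h ▸ hσ, h⟩, fun h => h.2⟩
  · simp only [mem_filter, mem_univ, true_and] at hF
    rw [(rank_eq_iff hn hd).2 hF.1, Nat.cast_one, mul_one]

end SignedCount

end RestrictedWhitney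

open RestrictedWhitney in
/-- The poset is ranked and the matrix of restricted Stirling numbers has a unique inverse, so all
the numbers involved are defined. For `k * d ≥ n` the truncated difference `n - k * d` is `0`, and
the Stirling number, the inverse entry and the number of forests with that index are all `0`. -/
theorem theorem1p2 (n d : ℕ) (hn : 1 ≤ n) (hd : 1 ≤ d) :
    Nonempty (GradeMinOrder ℕ (PartitionPoset n d)) ∧
    (∃! B, IsInverse (stirlingMatrix (progression d)) B) ∧
    ∀ [GradeMinOrder ℕ (PartitionPoset n d)] (k : ℕ),
      whitneySecond (PartitionPoset n d) k = stirling (progression d) n (n - k * d) ∧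
      whitneyFirst (PartitionPoset n d) k = inverseStirling (progression d) n (n - k * d) ∧
      (goodForests d n (n - k * d)).Finite ∧
      whitneyFirst (PartitionPoset n d) k
        = (-1) ^ k * ((goodForests d n (n - k * d)).ncard : ℤ) := by
  refine ⟨nonempty_gradeMinOrder hd, existsUnique_isInverse hd, fun k => ?_⟩
  refine ⟨whitneySecond_eq hn hd k, ?_, finite_goodForests d n _, ?_⟩
  · rw [whitneyFirst_eq hn hd, inverseStirling_eq hd hn]
  · rw [whitneyFirst_eq hn hd, moebiusSum_eq hn hd]
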